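/- **Setting.** Let $\bar x\in\{0,1\}^n$, $\bar y\in\{0,1\}^m$, $\bar z\in\{0,1\}^l$, and let $\bar{\mathcal W}=\bar x\otimes\bar y\otimes\bar z\in\{0,1\}^{n\times m\times l}$, i.e. $\bar w_{ijk}=\bar x_i\bar y_j\bar z_k$, be the ground truth. Let $r_{\bar x},r_{\bar y},r_{\bar z}$ be the ratios of the number of ones in $\bar x,\bar y,\bar z$ to their lengths $n,m,l$. In the *fully-random corruption model* with parameter $p\in[0,1]$ the entries of a random binary tensor are independent, and the $(i,j,k)$ entry equals $1-\bar w_{ijk}$ with probability $p$ and $\bar w_{ijk}$ with probability $1-p$. In the *semi-random corruption model* an adversary then modifies this tensor by an arbitrary finite sequence of monotone transformations, each of which reverts one corrupted entry to its value in $\bar{\mathcal W}$; the resulting tensor is $\mathcal G=(g_{ijk})$. With $S_0=\{(i,j,k):g_{ijk}=0\}$ and $S_1=\{(i,j,k):g_{ijk}=1\}$, the *standard LP* with input $\mathcal G$ is $$\begin{aligned}\min\ &\sum_{(i,j,k)\in S_0}w_{ijk}+\sum_{(i,j,k)\in S_1}(1-w_{ijk})\\ \text{s.t. } & w_{ijk}\le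 x_i,\ w_{ijk}\le y_j,\ w_{ijk}\le z_k\quad\forall (i,j,k)\in S_1,\\ & w_{ijk}\ge 0,\ w_{ijk}\ge x_i+y_j+z_k-2\quad\forall (i,j,k)\in S_0,\\ & (x,y,z)\in[0,1]^{n+m+l}.\end{aligned}$$ It *recovers the ground truth* if $(x,y,z,w)=(\bar x,\bar y,\bar z,\bar{\mathcal W})$ is its unique optimal solution. **Theorem.** Consider the semi-random corruption model. Assume that $r_{\bar x}\ge r_{\bar y}\ge r_{\bar z}>0$ are constants (independent of $n,m,l$), and that, as $n,m,l\to\infty$, $$n e^{-m},\quad n e^{-l},\quad m e^{-n},\quad m e^{-l},\quad l e^{-n},\quad l e^{-m}\ \to\ 0 .$$ Put $$\delta:=\tfrac12 r_{\bar x}r_{\bar y}+\tfrac12 r_{\bar x}r_{\bar z}-r_{\bar y}r_{\bar z}+r_{\bar x}-\tfrac12 r_{\bar y}-\tfrac12 r_{\bar z}.$$ Then $\delta\ge 0$, and if $p\in[0,1]$ is a constant with $$p<\frac{r_{\bar x}r_{\bar y}r_{\bar z}}{2(1+r_{\bar x}r_{\bar y}r_{\bar z})+\delta},$$ then the standard LP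 recovers the ground truth with high probability, i.e. with probability tending to $1$ as $n,m,l\to\infty$. -/

import Mathlib

open Filter Topology MeasureTheory ProbabilityTheory

/-- Binary `n × m × l` tensors (`true` is the entry 1, `false` is the entry 0). -/
abbrev BinTensor (n m l : ℕ) : Type := Fin n → Fin m → Fin l → Bool

/-- The outer product of three binary vectors. -/
def outerProd {n m l : ℕ} (x : Fin n → Bool) (y : Fin m → Bool) (z : Fin l → Bool) :
    BinTensor n m l :=
  fun i j k => x i && y j && z k

/-- The ratio of the number of ones of a binary vector to its number of elements. -/
noncomputable def density {n : ℕ} (x : Fin n → Bool) : ℝ :=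
  ((Finset.univ.filter (fun i => x i = true)).card : ℝ) / (n : ℝ)

/-- The real number 0 or 1 given by a bit. -/
def bitVal (b : Bool) : ℝ := if b then 1 else 0

/-! ### The corruption models -/

/-- `G` is distributed according to the fully-random corruption model with ground truth `W` and
corruption probability `p`: the entries of `G` are independent, and each one differs from the
corresponding entry of `W` with probability `p`. -/
structure IsFullyRandom {Ω : Type*} [MeasurableSpace Ω] {n m l : ℕ} (P : Measure Ω)
    (W : BinTensor n m l) (p : ℝ) (G : Ω → BinTensor n m l) : Prop where
  measurable : Measurable G
  indep : iIndepFun (fun (e : Fin n × Fin m × Fin l) (ω : Ω) => G ω e.1 e.2.1 e.2.2) P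
  corrupted : ∀ i j k, P {ω | G ω i j k = !(W i j k)} = ENNReal.ofReal p
  not_corrupted : ∀ i j k, P {ω | G ω i j k = W i j k} = ENNReal.ofReal (1 - p)

/-- The tensor `G` with its `(i, j, k)` entry replaced by `b`. -/
def setEntry {n m l : ℕ} (G : BinTensor n m l) (i : Fin n) (j : Fin m) (k : Fin l) (b : Bool) :
    BinTensor n m l :=
  fun i' j' k' => if i' = i ∧ j' = j ∧ k' = k then b else G i' j' k'

/-- A single monotone transformation relative to the ground truth `W`: an entry that is 1 in `W`
and 0 in `G` is reverted to 1, or an entry that is 0 in `W` and 1 in `G` is reverted to 0. -/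
def MonotoneStep {n m l : ℕ} (W G G' : BinTensor n m l) : Prop :=
  ∃ i j k,
    (W i j k = true ∧ G i j k = false ∧ G' = setEntry G i j k true) ∨
    (W i j k = false ∧ G i j k = true ∧ G' = setEntry G i j k false)

/-- `G` is a random tensor generated by the semi-random corruption model: it is obtained from a
fully-random tensor `G₀` by an arbitrary finite sequence of monotone transformations. The adversary
may use `G₀`, the ground truth, and any additional randomness available on `Ω`. -/
def IsSemiRandom {Ω : Type*} [MeasurableSpace Ω] {n m l : ℕ} (P : Measure Ω)
    (W : BinTensor n m l) (p : ℝ) (G : Ω → BinTensor n m l) : Prop :=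
  Measurable G ∧ ∃ G₀ : Ω → BinTensor n m l, IsFullyRandom P W p G₀ ∧
    ∀ᵐ ω ∂P, Relation.ReflTransGen (MonotoneStep W) (G₀ ω) (G ω)

/-! ### The standard LP -/

/-- The variables `(x, y, z, w)` of the standard LP. -/
@[ext]
structure LPPoint (n m l : ℕ) where
  x : Fin n → ℝ
  y : Fin m → ℝ
  z : Fin l → ℝ
  w : Fin n → Fin m → Fin l → ℝ

/-- Feasibility for the standard LP with input `G`; the condition `(i, j, k) ∈ S₁` is
`G i j k = true`, and `(i, j, k) ∈ S₀` is `G i j k = false`. -/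
structure SLPFeasible {n m l : ℕ} (G : BinTensor n m l) (v : LPPoint n m l) : Prop where
  le_x : ∀ i j k, G i j k = true → v.w i j k ≤ v.x i
  le_y : ∀ i j k, G i j k = true → v.w i j k ≤ v.y j
  le_z : ∀ i j k, G i j k = true → v.w i j k ≤ v.z k
  nonneg : ∀ i j k, G i j k = false → 0 ≤ v.w i j k
  ge_sum : ∀ i j k, G i j k = false → v.x i + v.y j + v.z k - 2 ≤ v.w i j k
  x_mem : ∀ i, v.x i ∈ Set.Icc (0 : ℝ) 1
  y_mem : ∀ j, v.y j ∈ Set.Icc (0 : ℝ) 1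
  z_mem : ∀ k, v.z k ∈ Set.Icc (0 : ℝ) 1

/-- The objective `∑_{S₀} w_{ijk} + ∑_{S₁} (1 - w_{ijk})` of the standard LP with input `G`. -/
noncomputable def slpObjective {n m l : ℕ} (G : BinTensor n m l) (v : LPPoint n m l) : ℝ :=
  ∑ i, ∑ j, ∑ k, if G i j k = true then 1 - v.w i j k else v.w i j k

/-- Optimal solutions of the standard LP with input `G`. -/
def SLPOptimal {n m l : ℕ} (G : BinTensor n m l) (v : LPPoint n m l) : Prop :=
  SLPFeasible G v ∧ ∀ v', SLPFeasible G v' → slpObjective G v ≤ slpObjective G v'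

/-- The point `(x, y, z, x ⊗ y ⊗ z)` given by three binary vectors. -/
def groundTruthPoint {n m l : ℕ} (x : Fin n → Bool) (y : Fin m → Bool) (z : Fin l → Bool) :
    LPPoint n m l where
  x := fun i => bitVal (x i)
  y := fun j => bitVal (y j)
  z := fun k => bitVal (z k)
  w := fun i j k => bitVal (outerProd x y z i j k)

/-- The standard LP with input `G` recovers the ground truth `x ⊗ y ⊗ z`: it has a unique optimal
solution, and this is `(x, y, z, x ⊗ y ⊗ z)`. -/
def SLPRecovers {n m l : ℕ} (x : Fin n → Bool) (y : Fin m → Bool) (z : Fin l → Bool)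
    (G : BinTensor n m l) : Prop :=
  SLPOptimal G (groundTruthPoint x y z) ∧
    ∀ v, SLPOptimal G v → v = groundTruthPoint x y z

/-- The quantity `δ` of the recovery threshold. -/
noncomputable def slpDelta (rx ry rz : ℝ) : ℝ :=
  1 / 2 * (rx * ry) + 1 / 2 * (rx * rz) - ry * rz + rx - 1 / 2 * ry - 1 / 2 * rz

/-! The proof is LP duality with an explicit certificate. Write `bitDev` for the deviation of a
coordinate from its true bit. The excess cost of each entry over the ground truth is at least a
linear form in its three deviations (`entry_bound`). An uncorrupted one gives the weights `αx, αy,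
αz`. An uncorrupted zero with exactly one zero coordinate gives +λ to that coordinate and -λ to the
other two, with λ one of `lx, ly, lz`. A corrupted one loses 1 in each coordinate. A corrupted zero
loses a total of 1, split equally among its zero coordinates.

These bounds survive the adversary, since a restored entry has nonnegative excess and coefficients
at most 0. Summing, recovery follows once every slice sum of coefficients is positive
(`slpRecovers_of_slice_sums_pos`), a condition on the independent pattern of initial corruptions
alone.

With r = rx ry rz, the weights can be chosen with all mean slice sums bounded below whenever p < r /
(2(1 + r)) (`exists_certWeights`); δ ≥ 0 makes the stated threshold no larger. Hoeffding's
inequality and a union bound over the slices finish the proof: a slice has area such as m l, so its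
failure probability is exponentially small in an area, against only linearly many slices. -/

/-! ### Linear lower bounds for the cost of one entry -/

/-- The coefficient, in the linear lower bound for the cost of one entry, of the deviation of the
coordinate with bit `b`; the other two coordinates have bits `b₂` and `b₃`, and `c` tells whether
the entry is corrupted. -/
noncomputable def certCoef (α lam lam₂ lam₃ : ℝ) : Bool → Bool → Bool → Bool → ℝ
  | true, true, true, false => α
  | true, true, false, false => -lam₃
  | true, false, true, false => -lam₂
  | true, false, false, false => 0
  | false, true, true, false => lam
  | false, _, _, false => 0
  | true, true, true, true => -1
  | true, _, _, true => 0
  | false, true, true, true => -1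
  | false, true, false, true => -1 / 2
  | false, false, true, true => -1 / 2
  | false, false, false, true => -1 / 3

/-- The distance of `x ∈ [0, 1]` from the bit `b`. -/
def bitDev (b : Bool) (x : ℝ) : ℝ := if b then 1 - x else x

lemma bitDev_nonneg {b : Bool} {x : ℝ} (hx : x ∈ Set.Icc (0 : ℝ) 1) : 0 ≤ bitDev b x := by
  cases b <;> simp [bitDev, hx.1, hx.2]

lemma eq_bitVal_of_bitDev_eq_zero {b : Bool} {x : ℝ} (h : bitDev b x = 0) : x = bitVal b := by
  cases b <;> simp [bitDev, bitVal] at * <;> linarith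

/-- The contribution of one entry to the objective of the standard LP. -/
noncomputable def entryCost (g : Bool) (w : ℝ) : ℝ := if g = true then 1 - w else w

lemma entryCost_injective (g : Bool) : Function.Injective (entryCost g) := by
  intro a b h
  cases g <;> simpa [entryCost] using h

/-- Weights of a dual certificate: `αx + αy + αz = 1` are the multipliers of the uncorrupted ones,
and `lx, ly, lz` those of the uncorrupted zeros with a single zero coordinate. -/
structure CertWeights where
  αx : ℝ
  αy : ℝ
  αz : ℝ
  lx : ℝ
  ly : ℝ
  lz : ℝ
  αx_nonneg : 0 ≤ αx
  αy_nonneg : 0 ≤ αy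
  αz_nonneg : 0 ≤ αz
  α_sum : αx + αy + αz = 1
  lx_mem : lx ∈ Set.Icc (0 : ℝ) 1
  ly_mem : ly ∈ Set.Icc (0 : ℝ) 1
  lz_mem : lz ∈ Set.Icc (0 : ℝ) 1

namespace CertWeights

/-- The coefficient of the deviation of the first coordinate. -/
noncomputable def coefX (C : CertWeights) (b₁ b₂ b₃ c : Bool) : ℝ :=
  certCoef C.αx C.lx C.ly C.lz b₁ b₂ b₃ c

/-- The coefficient of the deviation of the second coordinate. -/
noncomputable def coefY (C : CertWeights) (b₁ b₂ b₃ c : Bool) : ℝ :=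
  certCoef C.αy C.ly C.lx C.lz b₂ b₁ b₃ c

/-- The coefficient of the deviation of the third coordinate. -/
noncomputable def coefZ (C : CertWeights) (b₁ b₂ b₃ c : Bool) : ℝ :=
  certCoef C.αz C.lz C.lx C.ly b₃ b₁ b₂ c

/-- The linear lower bound for the cost of a single entry. The bit `c` says whether the entry was
corrupted before the adversary acted. -/
lemma entry_bound (C : CertWeights) {b₁ b₂ b₃ g c : Bool} {x y z w : ℝ}
    (hc : g ≠ (b₁ && b₂ && b₃) → c = true)
    (hx : x ∈ Set.Icc (0 : ℝ) 1) (hy : y ∈ Set.Icc (0 : ℝ) 1) (hz : z ∈ Set.Icc (0 : ℝ) 1)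
    (hwx : g = true → w ≤ x) (hwy : g = true → w ≤ y) (hwz : g = true → w ≤ z)
    (hw0 : g = false → 0 ≤ w) (hws : g = false → x + y + z - 2 ≤ w) :
    C.coefX b₁ b₂ b₃ c * bitDev b₁ x + C.coefY b₁ b₂ b₃ c * bitDev b₂ y
      + C.coefZ b₁ b₂ b₃ c * bitDev b₃ z
      ≤ entryCost g w - entryCost g (bitVal (b₁ && b₂ && b₃)) := by
  obtain ⟨αx, αy, αz, lx, ly, lz, hαx, hαy, hαz, hα, ⟨hlx, hlx'⟩, ⟨hly, hly'⟩, ⟨hlz, hlz'⟩⟩ := C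
  obtain ⟨hx0, hx1⟩ := hx
  obtain ⟨hy0, hy1⟩ := hy
  obtain ⟨hz0, hz1⟩ := hz
  -- `l * t` is a convex combination of 0 and `t`, both at most `w`.
  have scale : ∀ {l t : ℝ}, 0 ≤ l → l ≤ 1 → t ≤ w → 0 ≤ w → l * t ≤ w := fun h0 h1 ht hw => by
    nlinarith [mul_le_mul_of_nonneg_left ht h0, mul_le_mul_of_nonneg_right h1 hw]
  cases g
  · have h0 := hw0 rfl
    have hs := hws rfl
    have k1 := scale hlx hlx' hs h0
    have k2 := scale hly hly' hs h0
    have k3 := scale hlz hlz' hs h0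
    cases b₁ <;> cases b₂ <;> cases b₃ <;> cases c <;>
      simp [coefX, coefY, coefZ, certCoef, bitDev, bitVal, entryCost] at hc ⊢ <;> linarith
  · have h1 := hwx rfl
    have h2 := hwy rfl
    have h3 := hwz rfl
    -- The weights sum to 1, so this averages the three constraints on `w`.
    have k : αx * (1 - x) + αy * (1 - y) + αz * (1 - z) ≤ 1 - w := by
      nlinarith [mul_le_mul_of_nonneg_left h1 hαx, mul_le_mul_of_nonneg_left h2 hαy,
        mul_le_mul_of_nonneg_left h3 hαz]
    cases b₁ <;> cases b₂ <;> cases b₃ <;> cases c <;>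
      simp [coefX, coefY, coefZ, certCoef, bitDev, bitVal, entryCost] at hc ⊢ <;> linarith

end CertWeights

/-! ### Monotone transformations and the deterministic recovery criterion -/

lemma MonotoneStep.ne_of_ne {n m l : ℕ} {W G G' : BinTensor n m l} (h : MonotoneStep W G G')
    (i : Fin n) (j : Fin m) (k : Fin l) (hne : G' i j k ≠ W i j k) : G i j k ≠ W i j k := by
  obtain ⟨i', j', k', ⟨hW, -, rfl⟩ | ⟨hW, -, rfl⟩⟩ := h <;>
  · unfold setEntry at hne
    split_ifs at hne with hh
    · obtain ⟨rfl, rfl, rfl⟩ := hh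
      exact absurd hW.symm hne
    · exact hne

/-- The adversary never creates an error, so the corruption flags of the initial tensor account for
every wrong entry of the final one. -/
lemma ne_of_reflTransGen_monotoneStep {n m l : ℕ} {W G G' : BinTensor n m l}
    (h : Relation.ReflTransGen (MonotoneStep W) G G') (i : Fin n) (j : Fin m) (k : Fin l)
    (hne : G' i j k ≠ W i j k) : G i j k ≠ W i j k := by
  induction h with
  | refl => exact hne
  | tail _ hstep ih => exact ih (hstep.ne_of_ne i j k hne)

lemma slpFeasible_groundTruthPoint {n m l : ℕ} (x : Fin n → Bool) (y : Fin m → Bool)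
    (z : Fin l → Bool) (G : BinTensor n m l) : SLPFeasible G (groundTruthPoint x y z) := by
  have hmem : ∀ b, bitVal b ∈ Set.Icc (0 : ℝ) 1 := by intro b; cases b <;> simp [bitVal]
  refine ⟨?_, ?_, ?_, ?_, ?_, fun i => hmem _, fun j => hmem _, fun k => hmem _⟩ <;>
  · intro i j k _
    simp only [groundTruthPoint, outerProd]
    cases x i <;> cases y j <;> cases z k <;> norm_num [bitVal]

lemma slpObjective_eq_sum_entryCost {n m l : ℕ} (G : BinTensor n m l) (v : LPPoint n m l) :
    slpObjective G v = ∑ i, ∑ j, ∑ k, entryCost (G i j k) (v.w i j k) := rfl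

/-- If all slice sums of the coefficients are positive, the standard LP recovers the ground
truth. -/
theorem slpRecovers_of_slice_sums_pos {n m l : ℕ} (C : CertWeights) (x : Fin n → Bool)
    (y : Fin m → Bool) (z : Fin l → Bool) (G : BinTensor n m l)
    (c : Fin n → Fin m → Fin l → Bool)
    (hc : ∀ i j k, G i j k ≠ outerProd x y z i j k → c i j k = true)
    (hX : ∀ i, 0 < ∑ j, ∑ k, C.coefX (x i) (y j) (z k) (c i j k))
    (hY : ∀ j, 0 < ∑ i, ∑ k, C.coefY (x i) (y j) (z k) (c i j k))
    (hZ : ∀ k, 0 < ∑ i, ∑ j, C.coefZ (x i) (y j) (z k) (c i j k)) :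
    SLPRecovers x y z G := by
  have bound : ∀ v, SLPFeasible G v → ∀ i j k,
      C.coefX (x i) (y j) (z k) (c i j k) * bitDev (x i) (v.x i)
        + C.coefY (x i) (y j) (z k) (c i j k) * bitDev (y j) (v.y j)
        + C.coefZ (x i) (y j) (z k) (c i j k) * bitDev (z k) (v.z k)
      ≤ entryCost (G i j k) (v.w i j k)
        - entryCost (G i j k) ((groundTruthPoint x y z).w i j k) := fun v hv i j k =>
    C.entry_bound (hc i j k) (hv.x_mem i) (hv.y_mem j) (hv.z_mem k) (hv.le_x i j k)
      (hv.le_y i j k) (hv.le_z i j k) (hv.nonneg i j k) (hv.ge_sum i j k)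
  have total : ∀ v, SLPFeasible G v →
      ∑ i, (∑ j, ∑ k, C.coefX (x i) (y j) (z k) (c i j k)) * bitDev (x i) (v.x i)
        + ∑ j, (∑ i, ∑ k, C.coefY (x i) (y j) (z k) (c i j k)) * bitDev (y j) (v.y j)
        + ∑ k, (∑ i, ∑ j, C.coefZ (x i) (y j) (z k) (c i j k)) * bitDev (z k) (v.z k)
      ≤ slpObjective G v - slpObjective G (groundTruthPoint x y z) := by
    intro v hv
    have hY' : ∑ j, (∑ i, ∑ k, C.coefY (x i) (y j) (z k) (c i j k)) * bitDev (y j) (v.y j)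
        = ∑ i, ∑ j, ∑ k, C.coefY (x i) (y j) (z k) (c i j k) * bitDev (y j) (v.y j) := by
      rw [Finset.sum_comm]
      simp only [Finset.sum_mul]
    have hZ' : ∑ k, (∑ i, ∑ j, C.coefZ (x i) (y j) (z k) (c i j k)) * bitDev (z k) (v.z k)
        = ∑ i, ∑ j, ∑ k, C.coefZ (x i) (y j) (z k) (c i j k) * bitDev (z k) (v.z k) := by
      simp only [Finset.sum_mul]
      rw [Finset.sum_comm]
      exact Finset.sum_congr rfl fun i _ => Finset.sum_comm
    rw [hY', hZ', slpObjective_eq_sum_entryCost, slpObjective_eq_sum_entryCost]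
    simp only [Finset.sum_mul, ← Finset.sum_add_distrib, ← Finset.sum_sub_distrib]
    exact Finset.sum_le_sum fun i _ => Finset.sum_le_sum fun j _ => Finset.sum_le_sum fun k _ =>
      bound v hv i j k
  have nX : ∀ v, SLPFeasible G v → ∀ i ∈ Finset.univ, 0 ≤
      (∑ j, ∑ k, C.coefX (x i) (y j) (z k) (c i j k)) * bitDev (x i) (v.x i) := fun v hv i _ =>
    mul_nonneg (hX i).le (bitDev_nonneg (hv.x_mem i))
  have nY : ∀ v, SLPFeasible G v → ∀ j ∈ Finset.univ, 0 ≤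
      (∑ i, ∑ k, C.coefY (x i) (y j) (z k) (c i j k)) * bitDev (y j) (v.y j) := fun v hv j _ =>
    mul_nonneg (hY j).le (bitDev_nonneg (hv.y_mem j))
  have nZ : ∀ v, SLPFeasible G v → ∀ k ∈ Finset.univ, 0 ≤
      (∑ i, ∑ j, C.coefZ (x i) (y j) (z k) (c i j k)) * bitDev (z k) (v.z k) := fun v hv k _ =>
    mul_nonneg (hZ k).le (bitDev_nonneg (hv.z_mem k))
  have hfeas := slpFeasible_groundTruthPoint x y z G
  refine ⟨⟨hfeas, fun v hv => ?_⟩, fun v hv => ?_⟩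
  · linarith [total v hv, Finset.sum_nonneg (nX v hv), Finset.sum_nonneg (nY v hv),
      Finset.sum_nonneg (nZ v hv)]
  · obtain ⟨hv, hopt⟩ := hv
    have hle := hopt _ hfeas
    have t := total v hv
    have sX := Finset.sum_nonneg (nX v hv)
    have sY := Finset.sum_nonneg (nY v hv)
    have sZ := Finset.sum_nonneg (nZ v hv)
    have dX : ∀ i, bitDev (x i) (v.x i) = 0 := fun i =>
      (mul_eq_zero.mp ((Finset.sum_eq_zero_iff_of_nonneg (nX v hv)).mp (by linarith) i
        (Finset.mem_univ i))).resolve_left (hX i).ne'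
    have dY : ∀ j, bitDev (y j) (v.y j) = 0 := fun j =>
      (mul_eq_zero.mp ((Finset.sum_eq_zero_iff_of_nonneg (nY v hv)).mp (by linarith) j
        (Finset.mem_univ j))).resolve_left (hY j).ne'
    have dZ : ∀ k, bitDev (z k) (v.z k) = 0 := fun k =>
      (mul_eq_zero.mp ((Finset.sum_eq_zero_iff_of_nonneg (nZ v hv)).mp (by linarith) k
        (Finset.mem_univ k))).resolve_left (hZ k).ne'
    -- With all deviations zero the entrywise lower bound is 0; equality of the totals then forces
    -- equality of every entry cost, which determines `w`.
    have hge : ∀ i j k, entryCost (G i j k) ((groundTruthPoint x y z).w i j k)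
        ≤ entryCost (G i j k) (v.w i j k) := by
      intro i j k
      have := bound v hv i j k
      rw [dX, dY, dZ] at this
      linarith
    have heq : slpObjective G (groundTruthPoint x y z) = slpObjective G v :=
      le_antisymm (by linarith) hle
    rw [slpObjective_eq_sum_entryCost, slpObjective_eq_sum_entryCost] at heq
    have e1 := (Finset.sum_eq_sum_iff_of_le fun i _ => Finset.sum_le_sum fun j _ =>
      Finset.sum_le_sum fun k _ => hge i j k).mp heq
    ext i j k
    · exact eq_bitVal_of_bitDev_eq_zero (dX i)
    · exact eq_bitVal_of_bitDev_eq_zero (dY _)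
    · exact eq_bitVal_of_bitDev_eq_zero (dZ _)
    · have e2 := (Finset.sum_eq_sum_iff_of_le fun j _ =>
        Finset.sum_le_sum fun k _ => hge i j k).mp (e1 i (Finset.mem_univ i))
      have e3 := (Finset.sum_eq_sum_iff_of_le fun k _ => hge i j k).mp (e2 j (Finset.mem_univ j))
      exact (entryCost_injective _ (e3 k (Finset.mem_univ k))).symm

/-! ### Range and mean of the coefficients -/

lemma certCoef_mem_Icc {α lam lam₂ lam₃ : ℝ} (hα : α ∈ Set.Icc (0 : ℝ) 1)
    (h : lam ∈ Set.Icc (0 : ℝ) 1) (h₂ : lam₂ ∈ Set.Icc (0 : ℝ) 1)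
    (h₃ : lam₃ ∈ Set.Icc (0 : ℝ) 1) (b b₂ b₃ c : Bool) :
    certCoef α lam lam₂ lam₃ b b₂ b₃ c ∈ Set.Icc (-1 : ℝ) 1 := by
  obtain ⟨_, _⟩ := hα
  obtain ⟨_, _⟩ := h
  obtain ⟨_, _⟩ := h₂
  obtain ⟨_, _⟩ := h₃
  cases b <;> cases b₂ <;> cases b₃ <;> cases c <;> simp only [certCoef] <;>
    constructor <;> linarith

namespace CertWeights

lemma coefX_mem_Icc (C : CertWeights) (b₁ b₂ b₃ c : Bool) :
    C.coefX b₁ b₂ b₃ c ∈ Set.Icc (-1 : ℝ) 1 :=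
  certCoef_mem_Icc ⟨C.αx_nonneg, by linarith [C.α_sum, C.αy_nonneg, C.αz_nonneg]⟩
    C.lx_mem C.ly_mem C.lz_mem _ _ _ _

lemma coefY_mem_Icc (C : CertWeights) (b₁ b₂ b₃ c : Bool) :
    C.coefY b₁ b₂ b₃ c ∈ Set.Icc (-1 : ℝ) 1 :=
  certCoef_mem_Icc ⟨C.αy_nonneg, by linarith [C.α_sum, C.αx_nonneg, C.αz_nonneg]⟩
    C.ly_mem C.lx_mem C.lz_mem _ _ _ _

lemma coefZ_mem_Icc (C : CertWeights) (b₁ b₂ b₃ c : Bool) :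
    C.coefZ b₁ b₂ b₃ c ∈ Set.Icc (-1 : ℝ) 1 :=
  certCoef_mem_Icc ⟨C.αz_nonneg, by linarith [C.α_sum, C.αy_nonneg, C.αx_nonneg]⟩
    C.lz_mem C.lx_mem C.ly_mem _ _ _ _

end CertWeights

/-- The mean of `f` at a random bit that is `true` with probability `p`. -/
noncomputable def bitMean (p : ℝ) (f : Bool → ℝ) : ℝ := (1 - p) * f false + p * f true

lemma density_le_one {n : ℕ} (x : Fin n → Bool) : density x ≤ 1 := by
  refine div_le_one_of_le₀ ?_ (Nat.cast_nonneg n)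
  exact_mod_cast (Finset.card_filter_le _ _).trans (by simp)

lemma sum_apply_bit {n : ℕ} (x : Fin n → Bool) (f : Bool → ℝ) :
    ∑ i, f (x i) = n * bitMean (density x) f := by
  rcases Nat.eq_zero_or_pos n with rfl | hn
  · simp
  have hn' : (n : ℝ) ≠ 0 := by positivity
  have h : ∀ i, f (x i) = f false + (f true - f false) * (if x i = true then 1 else 0) := by
    intro i; cases x i <;> simp
  have hcard : (n : ℝ) * density x = ((Finset.univ.filter (fun i => x i = true)).card : ℝ) := by
    unfold density; field_simp
  simp only [h, Finset.sum_add_distrib, ← Finset.mul_sum, Finset.sum_boole, ← hcard]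
  simp [bitMean]
  ring

lemma sum_sum_apply_bit {n m : ℕ} (x : Fin n → Bool) (y : Fin m → Bool) (f : Bool → Bool → ℝ) :
    ∑ i, ∑ j, f (x i) (y j) =
      n * m * bitMean (density x) (fun b => bitMean (density y) (f b)) := by
  simp only [sum_apply_bit y]
  rw [sum_apply_bit x (fun b => (m : ℝ) * bitMean (density y) (f b))]
  simp only [bitMean]
  ring

/-- The mean coefficient over a slice with bit `false`, for corruption probability `p` and densities
`r₂`, `r₃` of the other two vectors. -/
lemma bitMean_certCoef_false {α lam lam₂ lam₃ p r₂ r₃ : ℝ} :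
    bitMean r₂ (fun b₂ => bitMean r₃ (fun b₃ => bitMean p
      (certCoef α lam lam₂ lam₃ false b₂ b₃))) =
      (1 - p) * (r₂ * r₃) * lam
        - p * (r₂ * r₃ + (r₂ * (1 - r₃) + r₃ * (1 - r₂)) / 2 + (1 - r₂) * (1 - r₃) / 3) := by
  simp only [bitMean, certCoef]; ring

/-- The last term is the load from uncorrupted zeros whose only zero coordinate lies in one of the
other two directions. -/
lemma bitMean_certCoef_true {α lam lam₂ lam₃ p r₂ r₃ : ℝ} :
    bitMean r₂ (fun b₂ => bitMean r₃ (fun b₃ => bitMean p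
      (certCoef α lam lam₂ lam₃ true b₂ b₃))) =
      r₂ * r₃ * ((1 - p) * α - p)
        - (1 - p) * (r₂ * (1 - r₃) * lam₃ + r₃ * (1 - r₂) * lam₂) := by
  simp only [bitMean, certCoef]; ring

/-- The corrupted mass charged to a zero coordinate in a slice. -/
noncomputable def zeroCharge (r₂ r₃ : ℝ) : ℝ :=
  r₂ * r₃ + (r₂ * (1 - r₃) + r₃ * (1 - r₂)) / 2 + (1 - r₂) * (1 - r₃) / 3

lemma zeroCharge_nonneg {r₂ r₃ : ℝ} (h₂ : r₂ ∈ Set.Icc (0 : ℝ) 1) (h₃ : r₃ ∈ Set.Icc (0 : ℝ) 1) :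
    0 ≤ zeroCharge r₂ r₃ := by
  have := mul_nonneg h₂.1 h₃.1
  have := mul_nonneg h₂.1 (sub_nonneg.2 h₃.2)
  have := mul_nonneg h₃.1 (sub_nonneg.2 h₂.2)
  have := mul_nonneg (sub_nonneg.2 h₂.2) (sub_nonneg.2 h₃.2)
  unfold zeroCharge; linarith

lemma zeroCharge_le_one {r₂ r₃ : ℝ} (h₂ : r₂ ∈ Set.Icc (0 : ℝ) 1) (h₃ : r₃ ∈ Set.Icc (0 : ℝ) 1) :
    zeroCharge r₂ r₃ ≤ 1 := by
  have := mul_nonneg h₂.1 (sub_nonneg.2 h₃.2)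
  have := mul_nonneg h₃.1 (sub_nonneg.2 h₂.2)
  have := mul_nonneg (sub_nonneg.2 h₂.2) (sub_nonneg.2 h₃.2)
  unfold zeroCharge; linarith

/-! ### Choice of the weights below the threshold -/

/-- The multiplier of the uncorrupted zeros with a single zero coordinate, together with the load
`t` which it puts on the uncorrupted ones. -/
lemma exists_zeroMultiplier {p r₁ r₂ r₃ g : ℝ} (h₁ : r₁ ∈ Set.Ioc (0 : ℝ) 1)
    (h₂ : r₂ ∈ Set.Ioc (0 : ℝ) 1) (h₃ : r₃ ∈ Set.Ioc (0 : ℝ) 1) (hp : 0 ≤ p) (hp1 : p < 1)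
    (hg0 : 0 < g) (hg : g = r₁ * r₂ * r₃ - p * (2 * (1 + r₁ * r₂ * r₃))) :
    ∃ lam ∈ Set.Icc (0 : ℝ) 1, (1 - p) * (r₂ * r₃) * lam = p * zeroCharge r₂ r₃ + g / 12 ∧
      ∃ t, 0 ≤ t ∧ r₁ * t = (1 - r₁) * lam := by
  have h₂' : r₂ ∈ Set.Icc (0 : ℝ) 1 := ⟨h₂.1.le, h₂.2⟩
  have h₃' : r₃ ∈ Set.Icc (0 : ℝ) 1 := ⟨h₃.1.le, h₃.2⟩
  have hr : 0 < r₂ * r₃ := mul_pos h₂.1 h₃.1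
  have hr1 : r₂ * r₃ ≤ 1 := mul_le_one₀ h₂.2 h₃.1.le h₃.2
  have hd : 0 < (1 - p) * (r₂ * r₃) := mul_pos (by linarith) hr
  have hle : r₁ * (r₂ * r₃) ≤ r₂ * r₃ := mul_le_of_le_one_left hr.le h₁.2
  have hpr : p * (r₂ * r₃) ≤ p := mul_le_of_le_one_right hp hr1
  have hpr' : 0 ≤ p * (r₁ * (r₂ * r₃)) := mul_nonneg hp (mul_nonneg h₁.1.le hr.le)
  have hz0 := mul_nonneg hp (zeroCharge_nonneg h₂' h₃')
  have hz1 : p * zeroCharge r₂ r₃ ≤ p := mul_le_of_le_one_right hp (zeroCharge_le_one h₂' h₃')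
  have hl0 : 0 ≤ (p * zeroCharge r₂ r₃ + g / 12) / ((1 - p) * (r₂ * r₃)) :=
    div_nonneg (by linarith) hd.le
  refine ⟨_, ⟨hl0, (div_le_one hd).2 ?_⟩, mul_div_cancel₀ _ hd.ne',
    (1 - r₁) * ((p * zeroCharge r₂ r₃ + g / 12) / ((1 - p) * (r₂ * r₃))) / r₁,
    div_nonneg (mul_nonneg (by linarith [h₁.2]) hl0) h₁.1.le, mul_div_cancel₀ _ h₁.1.ne'⟩
  -- For `lam ≤ 1`: both p `zeroCharge` and p r₂ r₃ are at most p, and r₂ r₃ - 2p ≥ r₁ r₂ r₃ - 2p ≥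
  -- g.
  rw [mul_assoc r₁] at hg
  linarith

/-- The slack left for the uncorrupted ones. -/
lemma half_le_slack {p q rx ry rz g lx ly lz tx ty tz : ℝ} (hg0 : 0 < g)
    (hg : g = rx * ry * rz - p * (2 * (1 + rx * ry * rz)))
    (hx : 0 < rx) (hy : 0 < ry) (hz : 0 < rz) (hq : (1 - p) * q = p)
    (ex : (1 - p) * (ry * rz) * lx = p * zeroCharge ry rz + g / 12)
    (ey : (1 - p) * (rx * rz) * ly = p * zeroCharge rx rz + g / 12)
    (ez : (1 - p) * (rx * ry) * lz = p * zeroCharge rx ry + g / 12)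
    (etx : rx * tx = (1 - rx) * lx) (ety : ry * ty = (1 - ry) * ly)
    (etz : rz * tz = (1 - rz) * lz) :
    g / 2 ≤ (1 - p) * (rx * ry * rz) * (1 - 3 * q - 2 * (tx + ty + tz)) := by
  have ux : (1 - p) * (rx * ry * rz) * tx = (1 - rx) * (p * zeroCharge ry rz + g / 12) := by
    rw [← ex]; linear_combination (1 - p) * ry * rz * etx
  have uy : (1 - p) * (rx * ry * rz) * ty = (1 - ry) * (p * zeroCharge rx rz + g / 12) := by
    rw [← ey]; linear_combination (1 - p) * rx * rz * ety
  have uz : (1 - p) * (rx * ry * rz) * tz = (1 - rz) * (p * zeroCharge rx ry + g / 12) := by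
    rw [← ez]; linear_combination (1 - p) * rx * ry * etz
  -- The charges satisfy Σ (1 - r₁) `zeroCharge` r₂ r₃ = 1 - rx ry rz over the three directions, as
  -- each zero of the tensor is charged once in total. This produces the factor 2(1 + r) in `g`.
  have hsr : (1 - p) * (rx * ry * rz) * (1 - 3 * q - 2 * (tx + ty + tz))
      = g - (3 - rx - ry - rz) * (g / 6) := by
    unfold zeroCharge at ux uy uz
    linear_combination -2 * (ux + uy + uz) - 3 * (rx * ry * rz) * hq - hg
  rw [hsr]
  linarith [mul_pos hg0 hx, mul_pos hg0 hy, mul_pos hg0 hz]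

/-- A dual certificate with positive mean slice sums exists below the threshold
`r / (2 (1 + r))`, where `r = rx ry rz`. -/
theorem exists_certWeights {p rx ry rz : ℝ} (hx : rx ∈ Set.Ioc (0 : ℝ) 1)
    (hy : ry ∈ Set.Ioc (0 : ℝ) 1) (hz : rz ∈ Set.Ioc (0 : ℝ) 1) (hp : 0 ≤ p)
    (h : p * (2 * (1 + rx * ry * rz)) < rx * ry * rz) :
    ∃ C : CertWeights, ∃ ε : ℝ, 0 < ε ∧
      (∀ b, ε ≤ bitMean ry fun b₂ => bitMean rz fun b₃ => bitMean p (C.coefX b b₂ b₃)) ∧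
      (∀ b, ε ≤ bitMean rx fun b₁ => bitMean rz fun b₃ => bitMean p (C.coefY b₁ b b₃)) ∧
      (∀ b, ε ≤ bitMean rx fun b₁ => bitMean ry fun b₂ => bitMean p (C.coefZ b₁ b₂ b)) := by
  have hr0 : 0 < rx * ry * rz := mul_pos (mul_pos hx.1 hy.1) hz.1
  have hp1 : p < 1 := by nlinarith [mul_nonneg hp hr0.le]
  have hq : 0 < 1 - p := by linarith
  obtain ⟨g, hg⟩ : ∃ g, g = rx * ry * rz - p * (2 * (1 + rx * ry * rz)) := ⟨_, rfl⟩
  have hg0 : 0 < g := by linarith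
  obtain ⟨lx, mx, ex, tx, htx0, etx⟩ := exists_zeroMultiplier hx hy hz hp hp1 hg0 hg
  obtain ⟨ly, my, ey, ty, hty0, ety⟩ := exists_zeroMultiplier hy hx hz hp hp1 hg0
    (by rw [hg, mul_comm ry rx])
  obtain ⟨lz, mz, ez, tz, htz0, etz⟩ := exists_zeroMultiplier hz hx hy hp hp1 hg0
    (by rw [hg, show rz * rx * ry = rx * ry * rz by ring])
  obtain ⟨q, hq0, eqp⟩ : ∃ q, 0 ≤ q ∧ (1 - p) * q = p :=
    ⟨p / (1 - p), div_nonneg hp hq.le, mul_div_cancel₀ _ hq.ne'⟩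
  have hsr := half_le_slack hg0 hg hx.1 hy.1 hz.1 eqp ex ey ez etx ety etz
  obtain ⟨s, hs⟩ : ∃ s, s = 1 - 3 * q - 2 * (tx + ty + tz) := ⟨_, rfl⟩
  rw [← hs] at hsr
  obtain ⟨hx0, hx1⟩ := hx
  obtain ⟨hy0, hy1⟩ := hy
  obtain ⟨hz0, hz1⟩ := hz
  have hqr : 0 < (1 - p) * (rx * ry * rz) := mul_pos hq hr0
  have hs0 : 0 < s := pos_of_mul_pos_right (lt_of_lt_of_le (by linarith) hsr) hqr.le
  have hqs : 0 < (1 - p) * s := mul_pos hq hs0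
  have bound : ∀ {r t : ℝ}, 0 ≤ t → 0 < r → r ≤ 1 → (1 - p) * (rx * ry * rz) * s = r * t →
      g / 12 ≤ t / 3 := by
    intro r t ht hr hr1 e
    have : r * t ≤ t := mul_le_of_le_one_left ht hr1
    linarith
  have marginX := bound (t := (1 - p) * s * (ry * rz)) (by positivity) hx0 hx1 (by ring)
  have marginY := bound (t := (1 - p) * s * (rx * rz)) (by positivity) hy0 hy1 (by ring)
  have marginZ := bound (t := (1 - p) * s * (rx * ry)) (by positivity) hz0 hz1 (by ring)
  -- Each α covers the corrupted ones (`q`) and the loads of the other two directions; the slack `s`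
  -- is shared equally, making the sum 1.
  refine ⟨⟨q + ty + tz + s / 3, q + tx + tz + s / 3,
    q + tx + ty + s / 3, lx, ly, lz, by positivity, by positivity, by positivity,
    by linarith, mx, my, mz⟩, g / 12, by linarith, ?_, ?_, ?_⟩
  · rintro (_ | _)
    · refine le_of_le_of_eq ?_ bitMean_certCoef_false.symm
      change _ ≤ _ - p * zeroCharge ry rz
      linarith
    · refine le_of_le_of_eq (marginX.trans_eq ?_) bitMean_certCoef_true.symm
      linear_combination -ry * rz * eqp - (1 - p) * (rz * ety + ry * etz)
  · rintro (_ | _)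
    · refine le_of_le_of_eq ?_ bitMean_certCoef_false.symm
      change _ ≤ _ - p * zeroCharge rx rz
      linarith
    · refine le_of_le_of_eq (marginY.trans_eq ?_) bitMean_certCoef_true.symm
      linear_combination -rx * rz * eqp - (1 - p) * (rz * etx + rx * etz)
  · rintro (_ | _)
    · refine le_of_le_of_eq ?_ bitMean_certCoef_false.symm
      change _ ≤ _ - p * zeroCharge rx ry
      linarith
    · refine le_of_le_of_eq (marginZ.trans_eq ?_) bitMean_certCoef_true.symm
      linear_combination -rx * ry * eqp - (1 - p) * (ry * etx + rx * ety)

/-! ### Concentration of the slice sums -/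

/-- Hoeffding's inequality for functions, with values in `[-1, 1]`, of independent random bits. -/
theorem measure_sum_apply_bit_nonpos_le {Ω ι : Type*} [MeasurableSpace Ω] [Fintype ι]
    {P : Measure Ω} [IsProbabilityMeasure P] {p ε : ℝ} (hp : 0 ≤ p) (hε : 0 ≤ ε)
    {B : ι → Ω → Bool} (hB : ∀ e, Measurable (B e)) (hind : iIndepFun B P)
    (hBp : ∀ e, P {ω | B e ω = true} = ENNReal.ofReal p)
    {f : ι → Bool → ℝ} (hf : ∀ e b, f e b ∈ Set.Icc (-1 : ℝ) 1)
    (hmean : ε * Fintype.card ι ≤ ∑ e, bitMean p (f e)) :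
    P {ω | ∑ e, f e (B e ω) ≤ 0} ≤ ENNReal.ofReal (Real.exp (-(ε ^ 2 * Fintype.card ι / 2))) := by
  have hint : ∀ e, ∫ ω, -f e (B e ω) ∂P = -bitMean p (f e) := by
    intro e
    have hset : MeasurableSet {ω | B e ω = true} := hB e (MeasurableSet.singleton true)
    have hfun : ∀ ω, -f e (B e ω) = -f e false
        + {ω | B e ω = true}.indicator (fun _ => f e false - f e true) ω := by
      intro ω
      by_cases h : B e ω = true
      · simp [h]; ring
      · simp [h]
    simp only [hfun]
    rw [integral_add (integrable_const _) ((integrable_const _).indicator hset),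
      integral_indicator_const _ hset]
    simp [measureReal_def, hBp, ENNReal.toReal_ofReal hp, bitMean]
    ring
  have hX : iIndepFun (fun e ω => -f e (B e ω) - ∫ ω', -f e (B e ω') ∂P) P :=
    hind.comp (fun e b => -f e b - ∫ ω', -f e (B e ω') ∂P) fun e => measurable_of_countable _
  have hsub : ∀ e ∈ Finset.univ, HasSubgaussianMGF
      (fun ω => -f e (B e ω) - ∫ ω', -f e (B e ω') ∂P) 1 P := by
    intro e _
    have := hasSubgaussianMGF_of_mem_Icc (μ := P) (X := fun ω => -f e (B e ω)) (a := -1) (b := 1)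
      (((measurable_of_countable fun b => -f e b).comp (hB e)).aemeasurable)
      (ae_of_all _ fun ω => ⟨by linarith [(hf e (B e ω)).2], by linarith [(hf e (B e ω)).1]⟩)
    have h1 : (‖(1 : ℝ) - -1‖₊ / 2) ^ 2 = 1 := by
      ext; norm_num
    rwa [h1] at this
  have key := HasSubgaussianMGF.measure_sum_ge_le_of_iIndepFun hX hsub
    (ε := ε * Fintype.card ι) (by positivity)
  have hincl : {ω | ∑ e, f e (B e ω) ≤ 0} ⊆
      {ω | ε * Fintype.card ι ≤ ∑ e, (-f e (B e ω) - ∫ ω', -f e (B e ω') ∂P)} := by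
    intro ω hω
    simp only [Set.mem_ofPred_eq, hint, Finset.sum_sub_distrib, Finset.sum_neg_distrib] at hω ⊢
    linarith
  refine (measure_mono hincl).trans ?_
  rw [← ofReal_measureReal]
  refine ENNReal.ofReal_le_ofReal (key.trans_eq ?_)
  congr 1
  -- The exponent is (εN)² / (2N); for N = 0 both sides are exp 0.
  rcases eq_or_ne (Fintype.card ι : ℝ) 0 with h0 | h0
  · simp [h0]
  · simp
    field_simp

namespace IsFullyRandom

variable {Ω : Type*} [MeasurableSpace Ω] {n m l : ℕ} {P : Measure Ω} {W : BinTensor n m l} {p : ℝ}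
  {G : Ω → BinTensor n m l}

lemma measurable_ne (hG : IsFullyRandom P W p G) (e : Fin n × Fin m × Fin l) :
    Measurable fun ω => G ω e.1 e.2.1 e.2.2 != W e.1 e.2.1 e.2.2 := by
  have h : Measurable fun ω => G ω e.1 e.2.1 e.2.2 :=
    (measurable_pi_apply _).comp ((measurable_pi_apply _).comp
      ((measurable_pi_apply _).comp hG.measurable))
  exact (measurable_of_countable fun b => b != W e.1 e.2.1 e.2.2).comp h

lemma iIndepFun_ne (hG : IsFullyRandom P W p G) :
    iIndepFun (fun (e : Fin n × Fin m × Fin l) ω => G ω e.1 e.2.1 e.2.2 != W e.1 e.2.1 e.2.2) P :=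
  hG.indep.comp (fun e b => b != W e.1 e.2.1 e.2.2) fun _ => measurable_of_countable _

lemma measure_ne (hG : IsFullyRandom P W p G) (e : Fin n × Fin m × Fin l) :
    P {ω | (G ω e.1 e.2.1 e.2.2 != W e.1 e.2.1 e.2.2) = true} = ENNReal.ofReal p := by
  rw [← hG.corrupted e.1 e.2.1 e.2.2]
  congr 1
  ext ω
  simp only [Set.mem_ofPred_eq]
  cases G ω e.1 e.2.1 e.2.2 <;> cases W e.1 e.2.1 e.2.2 <;> simp

/-- The tail bound for the sum of coefficients over the image of an injective map `φ` into the
entries, such as a slice. -/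
lemma measure_slice_sum_nonpos_le [IsProbabilityMeasure P] (hG : IsFullyRandom P W p G)
    (hp : 0 ≤ p) {ε : ℝ} (hε : 0 ≤ ε) {a b : ℕ} {u : Fin a → Bool} {v : Fin b → Bool}
    {φ : Fin a × Fin b → Fin n × Fin m × Fin l} (hφ : φ.Injective) {f : Bool → Bool → Bool → ℝ}
    (hf : ∀ b₁ b₂ c, f b₁ b₂ c ∈ Set.Icc (-1 : ℝ) 1)
    (hmean : ε ≤ bitMean (density u) fun b₁ => bitMean (density v) fun b₂ =>
      bitMean p (f b₁ b₂)) :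
    P {ω | ∑ i, ∑ j, f (u i) (v j) (G ω (φ (i, j)).1 (φ (i, j)).2.1 (φ (i, j)).2.2
        != W (φ (i, j)).1 (φ (i, j)).2.1 (φ (i, j)).2.2) ≤ 0} ≤
      ENNReal.ofReal (Real.exp (-(ε ^ 2 * (a * b) / 2))) := by
  have key := measure_sum_apply_bit_nonpos_le hp hε (fun e => hG.measurable_ne (φ e))
    (hG.iIndepFun_ne.precomp hφ) (fun e => hG.measure_ne (φ e))
    (f := fun e => f (u e.1) (v e.2)) (fun e c => hf _ _ _) (by
      rw [Fintype.sum_prod_type, sum_sum_apply_bit u v fun b₁ b₂ => bitMean p (f b₁ b₂)]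
      simp only [Fintype.card_prod, Fintype.card_fin, Nat.cast_mul]
      rw [mul_comm]
      exact mul_le_mul_of_nonneg_left hmean (by positivity))
  simpa only [Fintype.sum_prod_type, Fintype.card_prod, Fintype.card_fin, Nat.cast_mul] using key

end IsFullyRandom

/-! ### Union bound over slices and the limit -/

/-- A lower bound for the probability of recovery at fixed sizes. -/
theorem one_sub_measure_slpRecovers_le {Ω : Type*} [MeasurableSpace Ω] {n m l : ℕ}
    {P : Measure Ω} [IsProbabilityMeasure P] {x : Fin n → Bool} {y : Fin m → Bool}
    {z : Fin l → Bool} {p : ℝ} {G : Ω → BinTensor n m l}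
    (hG : IsSemiRandom P (outerProd x y z) p G) (hp : 0 ≤ p) (C : CertWeights) {ε : ℝ}
    (hε : 0 ≤ ε)
    (hX : ∀ b, ε ≤ bitMean (density y) fun b₂ => bitMean (density z) fun b₃ =>
      bitMean p (C.coefX b b₂ b₃))
    (hY : ∀ b, ε ≤ bitMean (density x) fun b₁ => bitMean (density z) fun b₃ =>
      bitMean p (C.coefY b₁ b b₃))
    (hZ : ∀ b, ε ≤ bitMean (density x) fun b₁ => bitMean (density y) fun b₂ =>
      bitMean p (C.coefZ b₁ b₂ b)) :
    1 - ENNReal.ofReal (n * Real.exp (-(ε ^ 2 * (m * l) / 2))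
      + m * Real.exp (-(ε ^ 2 * (n * l) / 2)) + l * Real.exp (-(ε ^ 2 * (n * m) / 2)))
      ≤ P {ω | SLPRecovers x y z (G ω)} := by
  obtain ⟨-, G₀, hG₀, hstep⟩ := hG
  set W := outerProd x y z with hW
  set R := {ω | SLPRecovers x y z (G ω)}
  set N := {ω | ¬ Relation.ReflTransGen (MonotoneStep W) (G₀ ω) (G ω)}
  set A := fun i => {ω | ∑ j, ∑ k, C.coefX (x i) (y j) (z k) (G₀ ω i j k != W i j k) ≤ 0}
  set B := fun j => {ω | ∑ i, ∑ k, C.coefY (x i) (y j) (z k) (G₀ ω i j k != W i j k) ≤ 0}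
  set D := fun k => {ω | ∑ i, ∑ j, C.coefZ (x i) (y j) (z k) (G₀ ω i j k != W i j k) ≤ 0}
  have hA : ∀ i, P (A i) ≤ ENNReal.ofReal (Real.exp (-(ε ^ 2 * (m * l) / 2))) := fun i =>
    hG₀.measure_slice_sum_nonpos_le hp hε (φ := fun e => (i, e.1, e.2))
      (fun e e' h => by simpa [Prod.ext_iff] using h) (f := C.coefX (x i))
      (fun _ _ _ => C.coefX_mem_Icc _ _ _ _) (hX (x i))
  have hB : ∀ j, P (B j) ≤ ENNReal.ofReal (Real.exp (-(ε ^ 2 * (n * l) / 2))) := fun j =>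
    hG₀.measure_slice_sum_nonpos_le hp hε (φ := fun e => (e.1, j, e.2))
      (fun e e' h => by simpa [Prod.ext_iff] using h) (f := fun b₁ b₃ => C.coefY b₁ (y j) b₃)
      (fun _ _ _ => C.coefY_mem_Icc _ _ _ _) (hY (y j))
  have hD : ∀ k, P (D k) ≤ ENNReal.ofReal (Real.exp (-(ε ^ 2 * (n * m) / 2))) := fun k =>
    hG₀.measure_slice_sum_nonpos_le hp hε (φ := fun e => (e.1, e.2, k))
      (fun e e' h => by simpa [Prod.ext_iff] using h) (f := fun b₁ b₂ => C.coefZ b₁ b₂ (z k))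
      (fun _ _ _ => C.coefZ_mem_Icc _ _ _ _) (hZ (z k))
  have union : ∀ {a : ℕ} {S : Fin a → Set Ω} {q : ℝ}, 0 ≤ q →
      (∀ i, P (S i) ≤ ENNReal.ofReal q) → P (⋃ i, S i) ≤ ENNReal.ofReal (a * q) := by
    intro a S q hq hS
    refine (measure_iUnion_fintype_le P S).trans ((Finset.sum_le_sum fun i _ => hS i).trans_eq ?_)
    simp [ENNReal.ofReal_mul]
  -- Covering the whole space and using subadditivity requires no measurability of the recovery
  -- event.
  have hcover : Set.univ ⊆ R ∪ (N ∪ ((⋃ i, A i) ∪ (⋃ j, B j) ∪ (⋃ k, D k))) := by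
    intro ω _
    by_contra hω
    simp only [Set.mem_union, Set.mem_iUnion, not_or, not_exists] at hω
    obtain ⟨hR, hN, ⟨hAω, hBω⟩, hDω⟩ := hω
    refine hR (slpRecovers_of_slice_sums_pos C x y z (G ω) (fun i j k => G₀ ω i j k != W i j k)
      (fun i j k h => ?_) (fun i => not_le.mp (hAω i)) (fun j => not_le.mp (hBω j))
      (fun k => not_le.mp (hDω k)))
    simpa using ne_of_reflTransGen_monotoneStep (not_not.mp hN) i j k h
  have hN : P N = 0 := hstep
  rw [tsub_le_iff_right]
  calc (1 : ENNReal) = P Set.univ := measure_univ.symm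
    _ ≤ P R + (P N + (P (⋃ i, A i) + P (⋃ j, B j) + P (⋃ k, D k))) := by
      refine (measure_mono hcover).trans ((measure_union_le _ _).trans ?_)
      gcongr
      refine (measure_union_le _ _).trans ?_
      gcongr
      refine (measure_union_le _ _).trans ?_
      gcongr
      exact measure_union_le _ _
    _ ≤ _ := by
      rw [hN, zero_add, ENNReal.ofReal_add (by positivity) (by positivity),
        ENNReal.ofReal_add (by positivity) (by positivity)]
      gcongr
      · exact union (Real.exp_pos _).le hA
      · exact union (Real.exp_pos _).le hB
      · exact union (Real.exp_pos _).le hD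

lemma slpDelta_nonneg {rx ry rz : ℝ} (hz : 0 < rz) (hzy : rz ≤ ry) (hyx : ry ≤ rx) :
    0 ≤ slpDelta rx ry rz := by
  have h1 := mul_le_mul_of_nonneg_right (hzy.trans hyx) (hz.le.trans hzy)
  have h2 := mul_le_mul_of_nonneg_right hyx hz.le
  unfold slpDelta
  linarith

/-- Exponential tails in the area of the slices beat exponential growth in one side. -/
lemma tendsto_mul_exp_area {n m l : ℕ → ℕ} {ε : ℝ} (hε : 0 < ε) (hl : Tendsto l atTop atTop)
    (h : Tendsto (fun t => (n t : ℝ) * Real.exp (-(m t : ℝ))) atTop (𝓝 0)) :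
    Tendsto (fun t => (n t : ℝ) * Real.exp (-(ε ^ 2 * (m t * l t) / 2))) atTop (𝓝 0) := by
  have hl' : Tendsto (fun t => (l t : ℝ)) atTop atTop := tendsto_natCast_atTop_atTop.comp hl
  refine squeeze_zero' (Eventually.of_forall fun t => by positivity) ?_ h
  -- Once l ≥ 2/ε², the exponent ε² m l / 2 is at least m.
  filter_upwards [hl'.eventually_ge_atTop (2 / ε ^ 2)] with t ht
  rw [div_le_iff₀ (by positivity)] at ht
  gcongr
  nlinarith [mul_le_mul_of_nonneg_left ht (Nat.cast_nonneg (α := ℝ) (m t))]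

theorem mainTheorem3 (rx ry rz : ℝ) (hz : 0 < rz) (hzy : rz ≤ ry) (hyx : ry ≤ rx) :
    0 ≤ slpDelta rx ry rz ∧
    ∀ (p : ℝ), 0 ≤ p → p ≤ 1 →
      p < rx * ry * rz / (2 * (1 + rx * ry * rz) + slpDelta rx ry rz) →
    ∀ (n m l : ℕ → ℕ),
      Tendsto n atTop atTop → Tendsto m atTop atTop → Tendsto l atTop atTop →
      Tendsto (fun t => (n t : ℝ) * Real.exp (-(m t : ℝ))) atTop (𝓝 0) →
      Tendsto (fun t => (n t : ℝ) * Real.exp (-(l t : ℝ))) atTop (𝓝 0) →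
      Tendsto (fun t => (m t : ℝ) * Real.exp (-(n t : ℝ))) atTop (𝓝 0) →
      Tendsto (fun t => (m t : ℝ) * Real.exp (-(l t : ℝ))) atTop (𝓝 0) →
      Tendsto (fun t => (l t : ℝ) * Real.exp (-(n t : ℝ))) atTop (𝓝 0) →
      Tendsto (fun t => (l t : ℝ) * Real.exp (-(m t : ℝ))) atTop (𝓝 0) →
    ∀ (x : ∀ t, Fin (n t) → Bool) (y : ∀ t, Fin (m t) → Bool) (z : ∀ t, Fin (l t) → Bool),
      (∀ t, density (x t) = rx) → (∀ t, density (y t) = ry) → (∀ t, density (z t) = rz) →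
    ∀ (Ω : ℕ → Type*) [∀ t, MeasurableSpace (Ω t)] (P : ∀ t, Measure (Ω t))
      [∀ t, IsProbabilityMeasure (P t)] (G : ∀ t, Ω t → BinTensor (n t) (m t) (l t)),
      (∀ t, IsSemiRandom (P t) (outerProd (x t) (y t) (z t)) p (G t)) →
      Tendsto (fun t => P t {ω | SLPRecovers (x t) (y t) (z t) (G t ω)}) atTop (𝓝 1) := by
  refine ⟨slpDelta_nonneg hz hzy hyx, ?_⟩
  intro p hp _ hpr n m l hn hm hl hnm hnl hmn hml hln hlm x y z hx hy hz' Ω _ P _ G hG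
  have hy0 : 0 < ry := hz.trans_le hzy
  have hx0 : 0 < rx := hy0.trans_le hyx
  have hx1 : rx ≤ 1 := hx 0 ▸ density_le_one (x 0)
  have hr0 : 0 < rx * ry * rz := by positivity
  have hδ := slpDelta_nonneg hz hzy hyx
  have hpr' : p * (2 * (1 + rx * ry * rz)) < rx * ry * rz := by
    rw [lt_div_iff₀ (by positivity)] at hpr
    linarith [mul_nonneg hp hδ]
  obtain ⟨C, ε, hε, hX, hY, hZ⟩ := exists_certWeights ⟨hx0, hx1⟩ ⟨hy0, hyx.trans hx1⟩
    ⟨hz, hzy.trans (hyx.trans hx1)⟩ hp hpr'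
  have key := fun t => one_sub_measure_slpRecovers_le (hG t) hp C hε.le
    (by rwa [hy t, hz' t]) (by rwa [hx t, hz' t]) (by rwa [hx t, hy t])
  refine tendsto_of_tendsto_of_tendsto_of_le_of_le ?_ tendsto_const_nhds key fun t => prob_le_one
  have hlim := ((tendsto_mul_exp_area hε hl hnm).add (tendsto_mul_exp_area hε hl hmn)).add
    (tendsto_mul_exp_area hε hm hln)
  have hlim' := ENNReal.Tendsto.sub (tendsto_const_nhds (x := (1 : ENNReal)))
    (ENNReal.tendsto_ofReal hlim) (Or.inl ENNReal.one_ne_top)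
  simpa using hlim'
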